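/- Let $\mathcal{C}$ be an additive and idempotent complete category. A right $\mathcal{C}$-module is a contravariant additive functor from $\mathcal{C}$ to the category $\mathrm{Ab}$ of abelian groups; it is finitely presented if there is an exact sequence $\mathcal{C}(-,X) \xrightarrow{\mathcal{C}(-,f)} \mathcal{C}(-,Y) \to F \to 0$ for some morphism $f \in \mathcal{C}(X,Y)$, where exactness means exactness at each object of $\mathcal{C}$. Let $\mathrm{mod}\,\mathcal{C}$ be the category of finitely presented right $\mathcal{C}$-modules and natural transformations, and let $\mathrm{mod}\,\mathcal{C}^{\mathrm{op}}$ be the same category for the opposite category $\mathcal{C}^{\mathrm{op}}$ (that is, the category of finitely presented covariant additive functors $\mathcal{C} \to \mathrm{Ab}$). Suppose that $\mathcal{C}$ is coherent, meaning that both $\mathrm{mod}\,\mathcal{C}$ and $\mathrm{mod}\,\mathcal{C}^{\mathrm{op}}$ are abelian categories. Then $$\mathrm{gl.dim}(\mathrm{mod}\,\mathcal{C}) = \mathrm{gl.dim}(\mathrm{mod}\,\mathcal{C}^{\mathrm{op}}),$$ where the global dimension of an abelian category is the supremum (possibly infinite) of the projective dimensions of its objects. -/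

import Mathlib

open CategoryTheory CategoryTheory.Limits

universe v u

namespace FunctorialApproach

section Abelian

/-- A preadditive category is abelian: it has finite products, kernels and cokernels, every
monomorphism is a kernel and every epimorphism is a cokernel. This is Mathlib's `Abelian`, as a
property of a given preadditive category. -/
class IsAbelianCategory (A : Type u) [Category.{v} A] [Preadditive A] : Prop where
  hasFiniteProducts : HasFiniteProducts A
  hasKernels : HasKernels A
  hasCokernels : HasCokernels A
  isNormalMono : IsNormalMonoCategory A
  isNormalEpi : IsNormalEpiCategory A

/-- The Mathlib structure carried by a preadditive category that is abelian. -/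
abbrev IsAbelianCategory.abelian (A : Type u) [Category.{v} A] [P : Preadditive A]
    [h : IsAbelianCategory A] : Abelian A :=
  { P, h.isNormalMono, h.isNormalEpi with
    has_finite_products := h.hasFiniteProducts
    has_kernels := h.hasKernels
    has_cokernels := h.hasCokernels }

/-- The global dimension of an abelian category: the supremum of the projective dimensions of its
objects. With Mathlib's convention a zero object has projective dimension `⊥`, so that the value
is `⊥` exactly when all objects are zero. -/
noncomputable def globalDimension (A : Type u) [Category.{v} A] [Abelian A] : WithBot ℕ∞ :=
  ⨆ X : A, projectiveDimension X

end Abelian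

section Modules

variable (C : Type u) [Category.{v} C] [Preadditive C]

/-- `F : Cᵒᵖ ⥤ Ab` is a finitely presented (right) `C`-module: it is additive and there is an exact
sequence `C(-, X) ⟶ C(-, Y) ⟶ F ⟶ 0` whose first map is `C(-, f)` for some `f : X ⟶ Y`.
Exactness of a sequence of functors is exactness at every object. -/
def finitelyPresented : ObjectProperty (Cᵒᵖ ⥤ AddCommGrpCat.{v}) := fun F =>
  F.Additive ∧ ∃ (X Y : C) (f : X ⟶ Y) (p : preadditiveYoneda.obj Y ⟶ F),
    ∀ Z : Cᵒᵖ, Function.Exact ((preadditiveYoneda.map f).app Z) (p.app Z) ∧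
      Function.Surjective (p.app Z)

/-- The category `mod C` of finitely presented (right) `C`-modules, with all natural
transformations as morphisms. The category of finitely presented left `C`-modules is
`FPMod Cᵒᵖ`. -/
abbrev FPMod := (finitelyPresented C).FullSubcategory

/-- `C` is right coherent if `mod C` is an abelian category. -/
class IsRightCoherent : Prop where
  right : IsAbelianCategory (FPMod C)

/-- `C` is left coherent if `mod Cᵒᵖ` is an abelian category. -/
class IsLeftCoherent : Prop where
  left : IsAbelianCategory (FPMod Cᵒᵖ)

/-- `C` is coherent if it is right coherent and left coherent. -/
class IsCoherent : Prop extends IsRightCoherent C, IsLeftCoherent C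

instance [h : IsRightCoherent C] : Abelian (FPMod C) :=
  haveI := h.right
  IsAbelianCategory.abelian (FPMod C)

instance [h : IsLeftCoherent C] : Abelian (FPMod Cᵒᵖ) :=
  haveI := h.left
  IsAbelianCategory.abelian (FPMod Cᵒᵖ)

end Modules

end FunctorialApproach

open Opposite

namespace FunctorialApproach

/-! ### Regular morphisms and their symmetric characterisation. -/

section Regular

variable {C : Type u} [Category.{v} C]

/-! Both global dimensions equal a Tor dimension, which is symmetric in left and right modules. The
cokernel of `C(-, f)` is projective iff `f` is regular (`projective_iff_isRegular`), and its
syzygies are presented by weak kernels (`exists_shortExact`). So global dimension at most `n` means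
that all `n`-th weak syzygies of morphisms of `C` are regular (`globalDimension_le_iff`).

Regularity of `f` is vanishing of Tor₁ against every `g`, a condition that `op` preserves while
exchanging `f` and `g`. Dimension shifting trades a weak kernel of `f` for a weak cokernel of `g`,
so the same holds in higher degrees and the criterion is self-dual (`forall_syzygyRegular_op_iff`).
-/

/-- `f` is von Neumann regular. -/
def IsRegular {X Y : C} (f : X ⟶ Y) : Prop := ∃ u : Y ⟶ X, f ≫ u ≫ f = f

/-- Every commutative square from `g` to `f` has the same diagonal as one that splits along a
morphism from the target of `g` to the source of `f`. If `f` has a weak kernel, this says that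
`Tor₁` of the cokernels of `C(-, f)` and `C(g, -)` vanishes. -/
def HasDiagonalFactorization {U V X Y : C} (g : U ⟶ V) (f : X ⟶ Y) : Prop :=
  ∀ (y : U ⟶ X) (z : V ⟶ Y), y ≫ f = g ≫ z → ∃ w : V ⟶ X, g ≫ w ≫ f = y ≫ f

lemma isRegular_iff_forall_hasDiagonalFactorization {X Y : C} (f : X ⟶ Y) :
    IsRegular f ↔ ∀ (U V : C) (g : U ⟶ V), HasDiagonalFactorization g f := by
  refine ⟨?_, fun h => ?_⟩
  · rintro ⟨u, hu⟩ U V g y z e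
    refine ⟨z ≫ u, ?_⟩
    have : g ≫ (z ≫ u) ≫ f = (g ≫ z) ≫ u ≫ f := by simp only [Category.assoc]
    rw [this, ← e, Category.assoc, hu]
  -- Testing `f` against itself, on the identity square, produces the quasi-inverse.
  · obtain ⟨w, hw⟩ := h X Y f (𝟙 X) (𝟙 Y) (by simp)
    exact ⟨w, by simpa using hw⟩

lemma hasDiagonalFactorization_op_iff {U V X Y : C} (g : U ⟶ V) (f : X ⟶ Y) :
    HasDiagonalFactorization f.op g.op ↔ HasDiagonalFactorization g f := by
  constructor
  · intro h y z e
    obtain ⟨w, hw⟩ := h z.op y.op (Quiver.Hom.unop_inj e.symm)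
    exact ⟨w.unop, by simpa [e] using Quiver.Hom.op_inj hw⟩
  · intro h y z e
    obtain ⟨w, hw⟩ := h z.unop y.unop (Quiver.Hom.op_inj e.symm)
    refine ⟨w.op, Quiver.Hom.unop_inj ?_⟩
    simpa using hw.trans (Quiver.Hom.op_inj e.symm)

end Regular

/-! ### Weak syzygies and balancing of Tor inside `C`. -/

section WeakKernels

variable {C : Type u} [Category.{v} C] [Preadditive C]

/-- `f'` is a weak kernel of `f`: it is killed by `f`, and every morphism killed by `f` factors
through it, not necessarily uniquely. -/
structure IsWeakKernel {W X Y : C} (f' : W ⟶ X) (f : X ⟶ Y) : Prop where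
  zero : f' ≫ f = 0
  exists_lift {Z : C} (a : Z ⟶ X) (ha : a ≫ f = 0) : ∃ b : Z ⟶ W, b ≫ f' = a

/-- `g'` is a weak cokernel of `g`. -/
structure IsWeakCokernel {X Y Z : C} (g : X ⟶ Y) (g' : Y ⟶ Z) : Prop where
  zero : g ≫ g' = 0
  exists_desc {W : C} (a : Y ⟶ W) (ha : g ≫ a = 0) : ∃ b : Z ⟶ W, g' ≫ b = a

lemma isWeakKernel_op_iff {X Y Z : C} (g : X ⟶ Y) (g' : Y ⟶ Z) :
    IsWeakKernel g'.op g.op ↔ IsWeakCokernel g g' := by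
  refine ⟨fun h => ⟨Quiver.Hom.op_inj h.zero, fun a ha => ?_⟩,
    fun h => ⟨Quiver.Hom.unop_inj h.zero, fun a ha => ?_⟩⟩
  · obtain ⟨b, hb⟩ := h.exists_lift a.op (Quiver.Hom.unop_inj ha)
    exact ⟨b.unop, Quiver.Hom.op_inj hb⟩
  · obtain ⟨b, hb⟩ := h.exists_desc a.unop (Quiver.Hom.op_inj ha)
    exact ⟨b.op, Quiver.Hom.unop_inj hb⟩

variable (C) in
/-- Every morphism of `C` has a weak kernel. -/
def HasWeakKernels : Prop :=
  ∀ ⦃X Y : C⦄ (f : X ⟶ Y), ∃ (W : C) (f' : W ⟶ X), IsWeakKernel f' f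

lemma HasWeakKernels.exists_isWeakCokernel (h : HasWeakKernels Cᵒᵖ) {X Y : C} (g : X ⟶ Y) :
    ∃ (Z : C) (g' : Y ⟶ Z), IsWeakCokernel g g' := by
  obtain ⟨W, g', hg'⟩ := h g.op
  exact ⟨W.unop, g'.unop, (isWeakKernel_op_iff g g'.unop).1 hg'⟩

/-- Dimension shifting. -/
lemma hasDiagonalFactorization_iff_of_isWeakKernel_of_isWeakCokernel {U V V' W X Y : C}
    {g : U ⟶ V} {g' : V ⟶ V'} {f' : W ⟶ X} {f : X ⟶ Y}
    (hf : IsWeakKernel f' f) (hg : IsWeakCokernel g g') :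
    HasDiagonalFactorization g f' ↔ HasDiagonalFactorization g' f := by
  constructor
  · intro h y z e
    obtain ⟨b, hb⟩ := hf.exists_lift (g ≫ y) (by
      rw [Category.assoc, e, ← Category.assoc, hg.zero, zero_comp])
    obtain ⟨w, hw⟩ := h b y hb
    obtain ⟨c, hc⟩ := hg.exists_desc (y - w ≫ f') (by rw [Preadditive.comp_sub, hw, hb, sub_self])
    refine ⟨c, ?_⟩
    rw [← Category.assoc, hc, Preadditive.sub_comp, Category.assoc, hf.zero, comp_zero, sub_zero]
  · intro h y z e
    obtain ⟨b, hb⟩ := hg.exists_desc (z ≫ f) (by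
      rw [← Category.assoc, ← e, Category.assoc, hf.zero, comp_zero])
    obtain ⟨w, hw⟩ := h z b hb.symm
    obtain ⟨c, hc⟩ := hf.exists_lift (z - g' ≫ w) (by
      rw [Preadditive.sub_comp, Category.assoc, hw, sub_self])
    refine ⟨c, ?_⟩
    rw [hc, Preadditive.comp_sub, ← Category.assoc, hg.zero, zero_comp, sub_zero, e]

/-- The `n`-th weak syzygies of `f` are regular. -/
def SyzygyRegular : ℕ → ∀ {X Y : C}, (X ⟶ Y) → Prop
  | 0, _, _, f => IsRegular f
  | n + 1, X, _, f => ∀ ⦃W : C⦄ (f' : W ⟶ X), IsWeakKernel f' f → SyzygyRegular n f'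

/-- Diagonals of squares from `g` to the `n`-th weak syzygies of `f` factor. -/
def SyzygyFactorization {U V : C} (g : U ⟶ V) : ℕ → ∀ {X Y : C}, (X ⟶ Y) → Prop
  | 0, _, _, f => HasDiagonalFactorization g f
  | n + 1, X, _, f => ∀ ⦃W : C⦄ (f' : W ⟶ X), IsWeakKernel f' f → SyzygyFactorization g n f'

lemma syzygyRegular_iff (n : ℕ) {X Y : C} (f : X ⟶ Y) :
    SyzygyRegular n f ↔ ∀ (U V : C) (g : U ⟶ V), SyzygyFactorization g n f := by
  induction n generalizing X Y with
  | zero => exact isRegular_iff_forall_hasDiagonalFactorization f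
  | succ n ih =>
    exact ⟨fun h U V g W f' hf' => (ih f').1 (h f' hf') U V g,
      fun h W f' hf' => (ih f').2 fun U V g => h U V g f' hf'⟩

/-- Balancing: the last syzygy taken on the side of `f` moves to the side of `g` by dimension
shifting. -/
lemma syzygyFactorization_succ_iff (h : HasWeakKernels C) (h' : HasWeakKernels Cᵒᵖ) (n : ℕ)
    {U V X Y : C} (g : U ⟶ V) (f : X ⟶ Y) :
    SyzygyFactorization g (n + 1) f ↔
      ∀ (V' : C) (g' : V ⟶ V'), IsWeakCokernel g g' → SyzygyFactorization g' n f := by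
  induction n generalizing X Y with
  | zero =>
    constructor
    · intro H V' g' hg'
      obtain ⟨W, f', hf'⟩ := h f
      exact (hasDiagonalFactorization_iff_of_isWeakKernel_of_isWeakCokernel hf' hg').1 (H f' hf')
    · intro H W f' hf'
      obtain ⟨V', g', hg'⟩ := h'.exists_isWeakCokernel g
      exact (hasDiagonalFactorization_iff_of_isWeakKernel_of_isWeakCokernel hf' hg').2
        (H V' g' hg')
  | succ n ih =>
    exact ⟨fun H V' g' hg' W f' hf' => (ih f').1 (H f' hf') V' g' hg',
      fun H W f' hf' => (ih f').2 fun V' g' hg' => H V' g' hg' f' hf'⟩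

lemma syzygyFactorization_op_iff (h : HasWeakKernels C) (h' : HasWeakKernels Cᵒᵖ) (n : ℕ)
    {U V X Y : C} (g : U ⟶ V) (f : X ⟶ Y) :
    SyzygyFactorization f.op n g.op ↔ SyzygyFactorization g n f := by
  induction n generalizing U V with
  | zero => exact hasDiagonalFactorization_op_iff g f
  | succ n ih =>
    rw [syzygyFactorization_succ_iff h h']
    exact ⟨fun H V' g' hg' => (ih g').1 (H g'.op ((isWeakKernel_op_iff g g').2 hg')),
      fun H V' g' hg' => (ih g'.unop).2 (H V'.unop g'.unop ((isWeakKernel_op_iff g g'.unop).1 hg'))⟩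

lemma forall_syzygyRegular_op_iff (h : HasWeakKernels C) (h' : HasWeakKernels Cᵒᵖ) (n : ℕ) :
    (∀ (X Y : Cᵒᵖ) (f : X ⟶ Y), SyzygyRegular n f) ↔
      ∀ (X Y : C) (f : X ⟶ Y), SyzygyRegular n f := by
  simp only [syzygyRegular_iff]
  exact ⟨fun H X Y f U V g => (syzygyFactorization_op_iff h h' n g f).1 (H _ _ g.op _ _ f.op),
    fun H X Y f U V g =>
      (syzygyFactorization_op_iff h h' n f.unop g.unop).2 (H _ _ g.unop _ _ f.unop)⟩

end WeakKernels

lemma exists_desc_of_exact_of_surjective {C : Type u} [Category.{v} C] {F G H K : Cᵒᵖ ⥤ AddCommGrpCat.{v}} (f : F ⟶ G)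
    (p : G ⟶ H) (h : ∀ Z, Function.Exact (f.app Z) (p.app Z) ∧ Function.Surjective (p.app Z))
    (q : G ⟶ K) (hq : f ≫ q = 0) : ∃ r : H ⟶ K, p ≫ r = q := by
  have hker : ∀ Z, (p.app Z).hom.ker ≤ (q.app Z).hom.ker := by
    intro Z x hx
    obtain ⟨y, rfl⟩ := ((h Z).1 x).1 hx
    exact ConcreteCategory.congr_hom (NatTrans.congr_app hq Z) y
  let r (Z) := (p.app Z).hom.liftOfSurjective (h Z).2 ⟨(q.app Z).hom, hker Z⟩
  have hr : ∀ Z x, r Z (p.app Z x) = q.app Z x := fun Z x =>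
    AddMonoidHom.liftOfRightInverse_comp_apply _ _ _ ⟨(q.app Z).hom, hker Z⟩ x
  refine ⟨{ app := fun Z => AddCommGrpCat.ofHom (r Z), naturality := fun Z W g => ?_ }, ?_⟩
  · ext x
    obtain ⟨y, rfl⟩ := (h Z).2 x
    have h1 := ConcreteCategory.congr_hom (p.naturality g) y
    have h2 := ConcreteCategory.congr_hom (q.naturality g) y
    change r W (H.map g (p.app Z y)) = K.map g (r Z (p.app Z y))
    rw [hr]
    refine (congrArg (r W) h1.symm).trans ((hr W _).trans h2)
  · ext Z x
    exact hr Z x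

/-! ### Presentations by representable functors. -/

section Representables

variable {C : Type u} [Category.{v} C] [Preadditive C]

lemma app_eq_map_app_id {F : Cᵒᵖ ⥤ AddCommGrpCat.{v}} {Z : C}
    (α : preadditiveYoneda.obj Z ⟶ F) {W : Cᵒᵖ} (a : W.unop ⟶ Z) :
    α.app W a = F.map a.op (α.app (op Z) (𝟙 Z)) := by
  have h := ConcreteCategory.congr_hom (α.naturality a.op) (𝟙 Z)
  refine Eq.trans ?_ h
  exact congrArg (α.app W) (Category.comp_id a).symm

lemma hom_ext_of_app_id {F : Cᵒᵖ ⥤ AddCommGrpCat.{v}} {Z : C}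
    {α β : preadditiveYoneda.obj Z ⟶ F} (h : α.app (op Z) (𝟙 Z) = β.app (op Z) (𝟙 Z)) :
    α = β := by
  ext W a
  exact (app_eq_map_app_id α a).trans ((congrArg _ h).trans (app_eq_map_app_id β a).symm)

lemma finitelyPresented_preadditiveYoneda (Y : C) :
    finitelyPresented C (preadditiveYoneda.obj Y) := by
  refine ⟨inferInstance, Y, Y, 0, 𝟙 _, fun Z => ⟨fun a => ?_, fun a => ⟨a, rfl⟩⟩⟩
  constructor
  · intro (h : a = 0)
    exact ⟨0, by rw [h, map_zero]⟩
  · rintro ⟨b, rfl⟩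
    exact comp_zero (C := C)

variable (C) in
/-- The Yoneda embedding into finitely presented modules. -/
def rep : C ⥤ FPMod C :=
  (finitelyPresented C).lift preadditiveYoneda finitelyPresented_preadditiveYoneda

instance : (rep C).Full := inferInstanceAs (ObjectProperty.lift _ _ _).Full
instance : (rep C).Faithful := inferInstanceAs (ObjectProperty.lift _ _ _).Faithful

instance : (preadditiveYoneda : C ⥤ Cᵒᵖ ⥤ AddCommGrpCat.{v}).Additive where
  map_add {X Y f g} := by
    ext Z a
    exact Preadditive.comp_add _ _ _ (show Z.unop ⟶ X from a) f g

instance : (rep C).Additive where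
  map_add {_ _ f g} := ObjectProperty.hom_ext _ (preadditiveYoneda.map_add (f := f) (g := g))

/-- `p` presents `F` as the cokernel of `C(-, f)` in such a way that the sequence is exact when
tested on representable functors. -/
structure IsPresentation {X Y : C} (f : X ⟶ Y) {F : FPMod C} (p : (rep C).obj Y ⟶ F) : Prop where
  zero : (rep C).map f ≫ p = 0
  exists_lift {Z : C} (a : Z ⟶ Y) (ha : (rep C).map a ≫ p = 0) : ∃ b : Z ⟶ X, b ≫ f = a
  exists_map_comp {Z : C} (x : (rep C).obj Z ⟶ F) : ∃ a : Z ⟶ Y, (rep C).map a ≫ p = x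
  exists_desc {G : FPMod C} (q : (rep C).obj Y ⟶ G) (hq : (rep C).map f ≫ q = 0) :
    ∃ r : F ⟶ G, p ≫ r = q
  epi : Epi p

lemma isPresentation_of_exact_of_surjective {X Y : C} (f : X ⟶ Y) {F : FPMod C}
    (p : preadditiveYoneda.obj Y ⟶ F.obj)
    (h : ∀ Z : Cᵒᵖ, Function.Exact ((preadditiveYoneda.map f).app Z) (p.app Z) ∧
      Function.Surjective (p.app Z)) :
    IsPresentation f (F := F) (ObjectProperty.homMk p) where
  zero := by
    apply ObjectProperty.hom_ext
    ext Z a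
    exact ((h Z).1 _).2 ⟨a, rfl⟩
  exists_lift {Z} a ha := by
    refine ((h (op Z)).1 a).1 ?_
    have := ConcreteCategory.congr_hom
      (NatTrans.congr_app (congrArg InducedCategory.Hom.hom ha) (op Z)) (𝟙 Z)
    refine Eq.trans ?_ this
    exact congrArg (p.app (op Z)) (Category.id_comp a).symm
  exists_map_comp {Z} x := by
    obtain ⟨a, ha⟩ := (h (op Z)).2 (x.hom.app (op Z) (𝟙 Z))
    refine ⟨a, ObjectProperty.hom_ext _ (hom_ext_of_app_id (Eq.trans ?_ ha))⟩
    exact congrArg (p.app (op Z)) (Category.id_comp a)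
  exists_desc {G} q hq := by
    obtain ⟨r, hr⟩ := exists_desc_of_exact_of_surjective _ p h q.hom
      (congrArg InducedCategory.Hom.hom hq)
    exact ⟨ObjectProperty.homMk r, ObjectProperty.hom_ext _ hr⟩
  epi := by
    rw [Preadditive.epi_iff_cancel_zero]
    intro G r hr
    apply ObjectProperty.hom_ext
    ext Z x
    obtain ⟨y, rfl⟩ := (h Z).2 x
    exact ConcreteCategory.congr_hom
      (NatTrans.congr_app (congrArg InducedCategory.Hom.hom hr) Z) y

lemma exists_presentation (F : FPMod C) :
    ∃ (X Y : C) (f : X ⟶ Y) (p : (rep C).obj Y ⟶ F), IsPresentation f p := by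
  obtain ⟨-, X, Y, f, p, h⟩ := F.property
  exact ⟨X, Y, f, _, isPresentation_of_exact_of_surjective f p h⟩

/-- Additivity passes from the representable functor to its pointwise quotient `F`. -/
lemma finitelyPresented_of_exact_of_surjective {X Y : C} (f : X ⟶ Y)
    {F : Cᵒᵖ ⥤ AddCommGrpCat.{v}} (p : preadditiveYoneda.obj Y ⟶ F)
    (h : ∀ Z : Cᵒᵖ, Function.Exact ((preadditiveYoneda.map f).app Z) (p.app Z) ∧
      Function.Surjective (p.app Z)) : finitelyPresented C F := by
  refine ⟨⟨fun {Z W a b} => ?_⟩, X, Y, f, p, h⟩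
  ext x
  obtain ⟨y, rfl⟩ := (h Z).2 x
  have nat (c : Z ⟶ W) := ConcreteCategory.congr_hom (p.naturality c) y
  have h1 : F.map (a + b) (p.app Z y) = p.app W ((preadditiveYoneda.obj Y).map (a + b) y) :=
    (nat _).symm
  have h2 := ConcreteCategory.congr_hom ((preadditiveYoneda.obj Y).map_add (f := a) (g := b)) y
  refine h1.trans ((congrArg (p.app W) h2).trans ((map_add (p.app W).hom _ _).trans ?_))
  exact congrArg₂ (· + ·) (nat a) (nat b)

lemma exists_isPresentation {X Y : C} (f : X ⟶ Y) :
    ∃ (F : FPMod C) (p : (rep C).obj Y ⟶ F), IsPresentation f p := by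
  let p := cokernel.π (preadditiveYoneda.map f)
  have h : ∀ Z : Cᵒᵖ, Function.Exact ((preadditiveYoneda.map f).app Z) (p.app Z) ∧
      Function.Surjective (p.app Z) := by
    intro Z
    refine ⟨?_, ?_⟩
    · exact (ShortComplex.ab_exact_iff_function_exact _).1
        ((ShortComplex.exact_cokernel (preadditiveYoneda.map f)).map
          ((evaluation Cᵒᵖ AddCommGrpCat.{v}).obj Z))
    · rw [← AddCommGrpCat.epi_iff_surjective]
      infer_instance
  exact ⟨⟨_, finitelyPresented_of_exact_of_surjective f p h⟩, _,
    isPresentation_of_exact_of_surjective f _ h⟩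

end Representables

/-! ### Projective dimension in terms of weak syzygies. -/

section Coherent

variable {C : Type u} [Category.{v} C] [Preadditive C]

/-- An epimorphism of `FPMod C` is not surjective by definition, but the pointwise cokernel of `φ`
is again finitely presented, hence zero. -/
lemma exists_map_comp_eq_of_epi [HasBinaryBiproducts C] {F G : FPMod C} (φ : F ⟶ G) [Epi φ]
    {Z : C} (x : (rep C).obj Z ⟶ G) : ∃ y : (rep C).obj Z ⟶ F, y ≫ φ = x := by
  obtain ⟨X, Y, f, p, hp⟩ := exists_presentation G
  obtain ⟨X', Y', f', p', hp'⟩ := exists_presentation F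
  obtain ⟨h, hh⟩ := hp.exists_map_comp (p' ≫ φ)
  -- `Q` is the cokernel of `φ`: the relations `f` of `G` plus the images `h` of the generators of
  -- `F`.
  obtain ⟨Q, q, hq⟩ := exists_isPresentation (biprod.desc f h)
  have hfq : (rep C).map f ≫ q = 0 := by
    rw [← biprod.inl_desc f h, Functor.map_comp, Category.assoc, hq.zero, comp_zero]
  have hhq : (rep C).map h ≫ q = 0 := by
    rw [← biprod.inr_desc f h, Functor.map_comp, Category.assoc, hq.zero, comp_zero]
  obtain ⟨r, hr⟩ := hp.exists_desc q hfq
  have := hp'.epi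
  have hφr : φ ≫ r = 0 := by
    rw [← cancel_epi p', ← Category.assoc, ← hh, Category.assoc, hr, hhq, comp_zero]
  have hr0 : r = 0 := by rw [← cancel_epi φ, hφr, comp_zero]
  obtain ⟨a, rfl⟩ := hp.exists_map_comp x
  obtain ⟨b, hb⟩ := hq.exists_lift a (by rw [← hr, hr0, comp_zero, comp_zero])
  refine ⟨(rep C).map (b ≫ biprod.snd) ≫ p', ?_⟩
  have hb' : a = (b ≫ biprod.fst) ≫ f + (b ≫ biprod.snd) ≫ h := by
    rw [← hb, biprod.desc_eq, Preadditive.comp_add, Category.assoc, Category.assoc]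
  rw [Category.assoc, ← hh, ← Category.assoc, ← Functor.map_comp, hb', Functor.map_add,
    Preadditive.add_comp, Functor.map_comp _ _ f, Category.assoc _ _ p, hp.zero, comp_zero, zero_add]

instance [HasBinaryBiproducts C] (Z : C) : Projective ((rep C).obj Z) where
  factors x φ _ := exists_map_comp_eq_of_epi φ x

lemma projective_iff_isRegular [HasBinaryBiproducts C] {X Y : C} {f : X ⟶ Y} {F : FPMod C}
    {p : (rep C).obj Y ⟶ F} (hp : IsPresentation f p) : Projective F ↔ IsRegular f := by
  have := hp.epi
  constructor
  · intro hF
    obtain ⟨s, hs⟩ := hF.factors (𝟙 F) p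
    -- The idempotent complementary to `p ≫ s` is killed by `p`, so it factors through `f`.
    obtain ⟨e, he⟩ := (rep C).map_surjective (𝟙 _ - p ≫ s)
    obtain ⟨u, rfl⟩ := hp.exists_lift e (by
      rw [he, Preadditive.sub_comp, Category.assoc, hs, Category.comp_id, Category.id_comp,
        sub_self])
    refine ⟨u, (rep C).map_injective ?_⟩
    rw [Functor.map_comp, he, Preadditive.comp_sub, ← Category.assoc, hp.zero, zero_comp,
      sub_zero, Category.comp_id]
  · rintro ⟨u, hu⟩
    obtain ⟨s, hs⟩ := hp.exists_desc ((rep C).map (𝟙 Y - u ≫ f)) (by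
      rw [← Functor.map_comp, Preadditive.comp_sub, hu, Category.comp_id, sub_self,
        Functor.map_zero])
    have hsp : s ≫ p = 𝟙 F := by
      rw [← cancel_epi p, ← Category.assoc, hs, Functor.map_sub, Preadditive.sub_comp,
        Functor.map_comp, Category.assoc, hp.zero, comp_zero, sub_zero, CategoryTheory.Functor.map_id,
        Category.id_comp, Category.comp_id]
    refine ⟨fun {E G} x φ _ => ?_⟩
    obtain ⟨y, hy⟩ := exists_map_comp_eq_of_epi φ (p ≫ x)
    exact ⟨s ≫ y, by rw [Category.assoc, hy, ← Category.assoc, hsp, Category.id_comp]⟩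

variable [IsRightCoherent C]

variable (C) in
-- A weak kernel is a representable cover of the kernel of `C(-, f)` in the abelian category `FPMod
-- C`.
lemma hasWeakKernels : HasWeakKernels C := by
  intro X Y f
  obtain ⟨U, W, g, p, hp⟩ := exists_presentation (kernel ((rep C).map f))
  obtain ⟨f', hf'⟩ := (rep C).map_surjective (p ≫ kernel.ι ((rep C).map f))
  refine ⟨W, f', (rep C).map_injective ?_, fun a ha => ?_⟩
  · rw [Functor.map_comp, hf', Category.assoc, kernel.condition, comp_zero, Functor.map_zero]
  · obtain ⟨b, hb⟩ := hp.exists_map_comp (kernel.lift ((rep C).map f) ((rep C).map a) (by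
      rw [← Functor.map_comp, ha, Functor.map_zero]))
    refine ⟨b, (rep C).map_injective ?_⟩
    rw [Functor.map_comp, hf', ← Category.assoc, hb, kernel.lift_ι]

/-- The cokernel of a weak kernel of `f` is a syzygy of the cokernel of `f`. -/
lemma exists_shortExact {W X Y : C} {f' : W ⟶ X} {f : X ⟶ Y} (hf : IsWeakKernel f' f)
    {F K : FPMod C} {p : (rep C).obj Y ⟶ F} (hp : IsPresentation f p)
    {p' : (rep C).obj X ⟶ K} (hp' : IsPresentation f' p') :
    ∃ (k : K ⟶ (rep C).obj Y) (w : k ≫ p = 0), (ShortComplex.mk k p w).ShortExact := by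
  have := hp'.epi
  obtain ⟨k, hk⟩ := hp'.exists_desc ((rep C).map f) (by
    rw [← Functor.map_comp, hf.zero, Functor.map_zero])
  have w : k ≫ p = 0 := by
    rw [← cancel_epi p', ← Category.assoc, hk, hp.zero, comp_zero]
  have hmono : Mono k := by
    rw [Preadditive.mono_iff_cancel_zero]
    intro G t ht
    obtain ⟨_, Z, _, π, hπ⟩ := exists_presentation G
    have := hπ.epi
    obtain ⟨a, ha⟩ := hp'.exists_map_comp (π ≫ t)
    have haf : a ≫ f = 0 := (rep C).map_injective (by
      rw [Functor.map_comp, ← hk, ← Category.assoc, ha, Category.assoc, ht, comp_zero,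
        Functor.map_zero])
    obtain ⟨b, rfl⟩ := hf.exists_lift a haf
    rw [← cancel_epi π, ← ha, Functor.map_comp, Category.assoc, hp'.zero, comp_zero, comp_zero]
  refine ⟨k, w, ?_⟩
  refine { exact := ?_, mono_f := hmono, epi_g := hp.epi }
  -- The refinement is a representable cover of `G`, on which maps to `(rep C).obj Y` are morphisms
  -- of `C`.
  rw [ShortComplex.exact_iff_exact_up_to_refinements]
  intro G t ht
  obtain ⟨_, Z, _, π, hπ⟩ := exists_presentation G
  obtain ⟨a, ha⟩ := (rep C).map_surjective (π ≫ t)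
  obtain ⟨b, rfl⟩ := hp.exists_lift a (by
    rw [ha, Category.assoc]
    exact (congrArg (π ≫ ·) ht).trans comp_zero)
  refine ⟨_, π, hπ.epi, (rep C).map b ≫ p', ?_⟩
  rw [← ha, Functor.map_comp, Category.assoc]
  exact congrArg ((rep C).map b ≫ ·) hk.symm

variable (C) in
lemma globalDimension_eq_bot_iff :
    globalDimension (FPMod C) = ⊥ ↔ ∀ X : C, 𝟙 X = 0 := by
  simp only [globalDimension, iSup_eq_bot, projectiveDimension_eq_bot_iff, IsZero.iff_id_eq_zero]
  constructor
  · intro h X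
    exact (rep C).map_injective (by rw [CategoryTheory.Functor.map_id, h, Functor.map_zero])
  · intro h F
    obtain ⟨X, Y, f, p, hp⟩ := exists_presentation F
    have := hp.epi
    rw [← cancel_epi p, Category.comp_id, comp_zero, ← Category.id_comp p, ← CategoryTheory.Functor.map_id, h,
      Functor.map_zero, zero_comp]

variable [HasBinaryBiproducts C]

lemma hasProjectiveDimensionLT_iff_syzygyRegular (n : ℕ) {X Y : C} {f : X ⟶ Y} {F : FPMod C}
    {p : (rep C).obj Y ⟶ F} (hp : IsPresentation f p) :
    HasProjectiveDimensionLT F (n + 1) ↔ SyzygyRegular n f := by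
  induction n generalizing X Y F with
  | zero => exact projective_iff_hasProjectiveDimensionLT_one.symm.trans (projective_iff_isRegular hp)
  | succ n ih =>
    have key {W : C} {f' : W ⟶ X} (hf' : IsWeakKernel f' f) :
        HasProjectiveDimensionLT F (n + 2) ↔ SyzygyRegular n f' := by
      obtain ⟨K, p', hp'⟩ := exists_isPresentation f'
      obtain ⟨k, w, hk⟩ := exists_shortExact hf' hp hp'
      exact (hk.hasProjectiveDimensionLT_X₃_iff n
        (inferInstanceAs (Projective ((rep C).obj Y)))).trans (ih hp')
    refine ⟨fun h W f' hf' => (key hf').1 h, fun h => ?_⟩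
    obtain ⟨W, f', hf'⟩ := hasWeakKernels C f
    exact (key hf').2 (h f' hf')

variable (C) in
lemma globalDimension_le_iff (n : ℕ) :
    globalDimension (FPMod C) ≤ n ↔ ∀ (X Y : C) (f : X ⟶ Y), SyzygyRegular n f := by
  simp only [globalDimension, iSup_le_iff, projectiveDimension_le_iff]
  constructor
  · intro h X Y f
    obtain ⟨F, p, hp⟩ := exists_isPresentation f
    exact (hasProjectiveDimensionLT_iff_syzygyRegular n hp).1 (h F)
  · intro h F
    obtain ⟨X, Y, f, p, hp⟩ := exists_presentation F
    exact (hasProjectiveDimensionLT_iff_syzygyRegular n hp).2 (h X Y f)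

end Coherent

/-- Natural bounds do not separate `⊥` from `0`, hence the extra condition. -/
lemma eq_of_forall_le_natCast_iff {a b : WithBot ℕ∞} (hbot : a = ⊥ ↔ b = ⊥)
    (h : ∀ n : ℕ, a ≤ n ↔ b ≤ n) : a = b := by
  refine eq_of_forall_ge_iff fun c => ?_
  induction c with
  | bot => simpa using hbot
  | coe c =>
    induction c with
    | top => exact iff_of_true le_top le_top
    | coe n => exact h n

end FunctorialApproach

theorem theorem5 (C : Type u) [Category.{v} C] [Preadditive C] [HasFiniteBiproducts C]
    [IsIdempotentComplete C] [FunctorialApproach.IsCoherent C] :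
    FunctorialApproach.globalDimension (FunctorialApproach.FPMod C) =
      FunctorialApproach.globalDimension (FunctorialApproach.FPMod Cᵒᵖ) := by
  open FunctorialApproach in
  have : IsRightCoherent Cᵒᵖ := ⟨IsLeftCoherent.left⟩
  have : HasBinaryBiproducts C := hasBinaryBiproducts_of_finite_biproducts C
  have : HasBinaryBiproducts Cᵒᵖ := inferInstance
  refine eq_of_forall_le_natCast_iff ?_ fun n => ?_
  · refine (globalDimension_eq_bot_iff C).trans (Iff.trans ?_ (globalDimension_eq_bot_iff Cᵒᵖ).symm)
    exact ⟨fun h X => Quiver.Hom.unop_inj (h X.unop), fun h X => Quiver.Hom.op_inj (h (op X))⟩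
  · exact (globalDimension_le_iff C n).trans ((forall_syzygyRegular_op_iff (hasWeakKernels C)
      (hasWeakKernels Cᵒᵖ) n).symm.trans (globalDimension_le_iff Cᵒᵖ n).symm)
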